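/- Let $n$ be a natural number and let $\mathcal{A}_n^*$ be the set of all words (including the empty word) over the ordered alphabet $\mathcal{A}_n=\{1<2<\dots<n\}$. For a word $w$ let $\mathrm{wt}(w)=(|w|_1,\dots,|w|_n)$, where $|w|_a$ is the number of occurrences of $a$ in $w$. **Crystal graph.** For $i\in\{1,\dots,n-1\}$ the Kashiwara operators $\tilde e_i,\tilde f_i$ are the partial maps on $\mathcal{A}_n^*$, undefined on the empty word, given on letters by $\tilde e_i(i+1)=i$ and $\tilde f_i(i)=i+1$ (and undefined on every other letter), and on longer words by $$\tilde e_i(uv)=\begin{cases}\tilde e_i(u)\,v&\text{if }\tilde\epsilon_i(u)>\tilde\phi_i(v),\\ u\,\tilde e_i(v)&\text{if }\tilde\epsilon_i(u)\le\tilde\phi_i(v),\end{cases}\qquad \tilde f_i(uv)=\begin{cases}\tilde f_i(u)\,v&\text{if }\tilde\epsilon_i(u)\ge\tilde\phi_i(v),\\ u\,\tilde f_i(v)&\text{if }\tilde\epsilon_i(u)<\tilde\phi_i(v),\end{cases}$$ where $\tilde\epsilon_i(w)$ (respectively $\tilde\phi_i(w)$) is the largest $k\ge 0$ such that $\tilde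 e_i^{\,k}(w)$ (respectively $\tilde f_i^{\,k}(w)$) is defined. The crystal graph $\Gamma(\mathrm{plac}_n)$ is the labelled directed graph with vertex set $\mathcal{A}_n^*$ and an edge labelled $i$ from $w$ to $w'$ if and only if $w'=\tilde f_i(w)$. **Quasi-crystal graph.** A word has an $i$-inversion if it contains a symbol $i+1$ somewhere to the left of a symbol $i$. The quasi-Kashiwara operator $\ddot f_i(w)$ is defined if and only if $w$ has no $i$-inversion and contains the symbol $i$, and then it is obtained from $w$ by replacing the right-most symbol $i$ by $i+1$. The quasi-crystal graph $\Gamma(\mathrm{hypo}_n)$ is the labelled directed graph with vertex set $\mathcal{A}_n^*$ and an edge labelled $i$ from $w$ to $w'$ if and only if $w'=\ddot f_i(w)$. Let $\Gamma(\mathrm{plac}_n,w)$ and $\Gamma(\mathrm{hypo}_n,w)$ denote the connected components (of the underlying undirected graphs) containing $w$. A crystal isomorphism (respectively quasi-crystal isomorphism) between two connected components of $\Gamma(\mathrm{plac}_n)$ (respectively of $\Gamma(\mathrm{hypo}_n)$) is a bijection $\theta$ between their vertex sets such that $\mathrm{wt}(\theta(x))=\mathrm{wt}(x)$ for all $x$,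 and such that, for all vertices $x,y$ and every label $i$, there is an edge labelled $i$ from $x$ to $y$ if and only if there is an edge labelled $i$ from $\theta(x)$ to $\theta(y)$. **Proposition.** 1. Let $\Theta$ be a crystal isomorphism from $\Gamma(\mathrm{plac}_n,u)$ to a connected component of $\Gamma(\mathrm{plac}_n)$. Then for every $w\in\Gamma(\mathrm{plac}_n,u)$ the component $\Gamma(\mathrm{hypo}_n,w)$ is contained in $\Gamma(\mathrm{plac}_n,u)$, and $\Theta$ restricts to a quasi-crystal isomorphism from $\Gamma(\mathrm{hypo}_n,w)$ to $\Gamma(\mathrm{hypo}_n,\Theta(w))$. 2. The vertex set of every connected component of $\Gamma(\mathrm{plac}_n)$ is a union of vertex sets of connected components of $\Gamma(\mathrm{hypo}_n)$. -/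

import Mathlib

namespace QuasiCrystal

/-- Words over the ordered alphabet with `n` letters. The letter `a` of the alphabet
`{1 < 2 < ... < n}` is represented by the element `a - 1` of `Fin n`. -/
abbrev Word (n : ℕ) : Type := List (Fin n)

/-- The smaller letter (`i` in the usual notation) attached to an edge label.
The labels `1, ..., n - 1` are represented by the elements of `Fin (n - 1)`. -/
def lo {n : ℕ} (i : Fin (n - 1)) : Fin n := ⟨i.1, by omega⟩

/-- The larger letter (`i + 1` in the usual notation) attached to an edge label. -/
def hi {n : ℕ} (i : Fin (n - 1)) : Fin n := ⟨i.1 + 1, by omega⟩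

/-- The weight of a word: how often each letter occurs in it. -/
def wt {n : ℕ} (w : Word n) : Fin n → ℕ := fun a => w.count a

/-! ### Kashiwara operators

Partially defined operators are functions to `Option`, with value `none` where undefined. -/

/-- The `k`-fold iterate of a partial map. -/
def iter {α : Type} (g : α → Option α) (k : ℕ) (x : α) : Option α :=
  (fun y : Option α => y.bind g)^[k] (some x)

/-- The largest `k` such that the `k`-fold iterate of the partial map `g` is defined at `x`. -/
noncomputable def iterCount {α : Type} (g : α → Option α) (x : α) : ℕ :=
  sSup {k : ℕ | (iter g k x).isSome}

/-- The pair of the raising and the lowering operator for the label `i`, correct on words of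
length at most `m` and defined by recursion on `m`. On a single letter both come from the crystal
basis; a longer word is split as its first letter followed by the rest. -/
noncomputable def kashiwaraAux {n : ℕ} (i : Fin (n - 1)) :
    ℕ → (Word n → Option (Word n)) × (Word n → Option (Word n))
  | 0 => (fun _ => none, fun _ => none)
  | m + 1 =>
    let e := (kashiwaraAux i m).1
    let f := (kashiwaraAux i m).2
    (fun w => match w with
      | [] => none
      | [a] => if a = hi i then some [lo i] else none
      | a :: b :: v =>
        if iterCount e [a] > iterCount f (b :: v) then (e [a]).map (· ++ (b :: v))
        else (e (b :: v)).map ([a] ++ ·),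
     fun w => match w with
      | [] => none
      | [a] => if a = lo i then some [hi i] else none
      | a :: b :: v =>
        if iterCount e [a] ≥ iterCount f (b :: v) then (f [a]).map (· ++ (b :: v))
        else (f (b :: v)).map ([a] ++ ·))

/-- The raising Kashiwara operator. -/
noncomputable def ke {n : ℕ} (i : Fin (n - 1)) (w : Word n) : Option (Word n) :=
  (kashiwaraAux i w.length).1 w

/-- The lowering Kashiwara operator. -/
noncomputable def kf {n : ℕ} (i : Fin (n - 1)) (w : Word n) : Option (Word n) :=
  (kashiwaraAux i w.length).2 w

/-- The number of times the raising Kashiwara operator can be applied. -/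
noncomputable def keCount {n : ℕ} (i : Fin (n - 1)) (w : Word n) : ℕ := iterCount (ke i) w

/-- The number of times the lowering Kashiwara operator can be applied. -/
noncomputable def kfCount {n : ℕ} (i : Fin (n - 1)) (w : Word n) : ℕ := iterCount (kf i) w

/-! ### Quasi-Kashiwara operators -/

/-- The word `u` has an `i`-inversion: it has `(i + 1) i` as a (scattered) subsequence. -/
def HasInversion {n : ℕ} (i : Fin (n - 1)) (u : Word n) : Prop := [hi i, lo i].Sublist u

/-- Replace the left-most symbol `a` of a word by `b`. -/
def replaceLeftmost {n : ℕ} (a b : Fin n) (u : Word n) : Word n := u.replace a b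

/-- Replace the right-most symbol `a` of a word by `b`. -/
def replaceRightmost {n : ℕ} (a b : Fin n) (u : Word n) : Word n :=
  (replaceLeftmost a b u.reverse).reverse

open Classical in
/-- The raising quasi-Kashiwara operator. -/
noncomputable def qe {n : ℕ} (i : Fin (n - 1)) (u : Word n) : Option (Word n) :=
  if ¬ HasInversion i u ∧ hi i ∈ u then some (replaceLeftmost (hi i) (lo i) u) else none

open Classical in
/-- The lowering quasi-Kashiwara operator. -/
noncomputable def qf {n : ℕ} (i : Fin (n - 1)) (u : Word n) : Option (Word n) :=
  if ¬ HasInversion i u ∧ lo i ∈ u then some (replaceRightmost (lo i) (hi i) u) else none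

/-! ### The two graphs, their connected components and isomorphisms -/

/-- The edges of a directed graph on the words whose edges are labelled by `1, ..., n - 1`:
`G i w w'` says that there is an edge with label `i` from `w` to `w'`. -/
abbrev LabelledDigraph (n : ℕ) : Type := Fin (n - 1) → Word n → Word n → Prop

/-- The crystal graph of the plactic monoid. -/
def crystalGraph (n : ℕ) : LabelledDigraph n := fun i w w' => kf i w = some w'

/-- The quasi-crystal graph of the hypoplactic monoid. -/
def quasiCrystalGraph (n : ℕ) : LabelledDigraph n := fun i w w' => qf i w = some w'

/-- The vertex set of the connected component containing `w` (directions and labels of edges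
are disregarded). -/
def component {n : ℕ} (G : LabelledDigraph n) (w : Word n) : Set (Word n) :=
  {x | Relation.EqvGen (fun y z => ∃ i, G i y z) w x}

/-- `θ`, a map from the component of `w` to the component of `w'`, is a weight-preserving
labelled digraph isomorphism. For the crystal graph these are the crystal isomorphisms, for the
quasi-crystal graph they are the quasi-crystal isomorphisms. -/
structure IsComponentIso {n : ℕ} (G : LabelledDigraph n) {w w' : Word n}
    (θ : component G w → component G w') : Prop where
  bijective : Function.Bijective θ
  wt_eq : ∀ x, wt (θ x : Word n) = wt (x : Word n)
  edge_iff : ∀ (i : Fin (n - 1)) (x y : component G w),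
    G i (x : Word n) (y : Word n) ↔ G i (θ x : Word n) (θ y : Word n)

/-! ### The Kashiwara operators satisfy the recursion for every factorization

The lemmas below check that the definition above does not depend on the chosen factorization
and that the two counts are attained maxima. -/

section WellDefined

variable {n : ℕ}

/-- Closed recursive form of the two counts (raising, lowering). -/
def sig (i : Fin (n - 1)) : Word n → ℕ × ℕ
  | [] => (0, 0)
  | a :: v =>
    ((sig i v).1 + ((if a = hi i then 1 else 0) - (sig i v).2),
     (if a = lo i then 1 else 0) + ((sig i v).2 - (if a = hi i then 1 else 0)))

/-- Closed recursive form of the raising operator. -/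
def sigE (i : Fin (n - 1)) : Word n → Option (Word n)
  | [] => none
  | a :: v => if a = hi i ∧ (sig i v).2 = 0 then some (lo i :: v) else (sigE i v).map (a :: ·)

/-- Closed recursive form of the lowering operator. -/
def sigF (i : Fin (n - 1)) : Word n → Option (Word n)
  | [] => none
  | a :: v =>
    if (sig i v).2 ≤ (if a = hi i then 1 else 0) then
      (if a = lo i then some (hi i :: v) else none)
    else (sigF i v).map (a :: ·)

theorem lo_ne_hi (i : Fin (n - 1)) : lo i ≠ hi i := by
  simp [lo, hi]

theorem sigE_spec (i : Fin (n - 1)) (w : Word n) :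
    (sigE i w = none ↔ (sig i w).1 = 0) ∧
    ∀ w', sigE i w = some w' → w'.length = w.length ∧ (sig i w).1 = (sig i w').1 + 1 ∧
      (sig i w').2 = (sig i w).2 + 1 := by
  induction w with
  | nil => simp [sigE, sig]
  | cons a v ih =>
    obtain ⟨ih1, ih2⟩ := ih
    have hne := lo_ne_hi i
    by_cases h : a = hi i ∧ (sig i v).2 = 0
    · refine ⟨?_, ?_⟩
      · simp [sigE, sig, h]
      · intro w' hw'
        simp only [sigE, h, and_self, if_true, Option.some.injEq] at hw'
        subst hw'
        simp [sig, h, hne, hne.symm]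
    · refine ⟨?_, ?_⟩
      · simp only [sigE, h, if_false, Option.map_eq_none_iff, ih1, sig]
        by_cases ha : a = hi i <;> simp [ha] at h ⊢ <;> omega
      · intro w' hw'
        simp only [sigE, h, if_false, Option.map_eq_some_iff] at hw'
        obtain ⟨v', hv', rfl⟩ := hw'
        obtain ⟨h1, h2, h3⟩ := ih2 v' hv'
        refine ⟨by simp [h1], ?_⟩
        simp only [sig]
        by_cases ha : a = hi i
        · simp [ha, hne.symm] at h ⊢; omega
        · simp [ha] at h ⊢; omega

theorem sigF_spec (i : Fin (n - 1)) (w : Word n) :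
    (sigF i w = none ↔ (sig i w).2 = 0) ∧
    ∀ w', sigF i w = some w' → w'.length = w.length ∧ (sig i w).2 = (sig i w').2 + 1 := by
  induction w with
  | nil => simp [sigF, sig]
  | cons a v ih =>
    obtain ⟨ih1, ih2⟩ := ih
    have hne := lo_ne_hi i
    by_cases h : (sig i v).2 ≤ (if a = hi i then 1 else 0)
    · by_cases ha : a = lo i
      · subst ha
        simp [hne] at h
        refine ⟨by simp [sigF, sig, h], ?_⟩
        intro w' hw'
        simp [sigF, h] at hw'
        subst hw'
        simp [sig, h, hne, hne.symm]
      · refine ⟨?_, by simp [sigF, h, ha]⟩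
        simp only [sigF, h, if_true, ha, if_false, sig, true_iff]
        omega
    · refine ⟨?_, ?_⟩
      · simp only [sigF, h, if_false, Option.map_eq_none_iff, ih1, sig]
        omega
      · intro w' hw'
        simp only [sigF, h, if_false, Option.map_eq_some_iff] at hw'
        obtain ⟨v', hv', rfl⟩ := hw'
        obtain ⟨h1, h2⟩ := ih2 v' hv'
        refine ⟨by simp [h1], ?_⟩
        simp only [sig]
        omega

theorem iter_succ {α : Type} (g : α → Option α) (k : ℕ) (x : α) :
    iter g (k + 1) x = (g x).bind (iter g k) := by
  have hn : ∀ k : ℕ, (fun y : Option α => y.bind g)^[k] none = none := by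
    intro k
    induction k with
    | zero => rfl
    | succ k ih => rw [Function.iterate_succ_apply']; simp [ih]
  rw [iter, Function.iterate_succ_apply]
  cases h : g x with
  | none => simp [h, hn]
  | some y => simp [h, iter]

/-- If `c` vanishes exactly where `g` is undefined and drops by one along `g`, then it counts how
often `g` can be applied. -/
theorem iterCount_eq {α : Type} (g : α → Option α) (c : α → ℕ) (S : α → Prop)
    (h0 : ∀ x, S x → (g x = none ↔ c x = 0))
    (h1 : ∀ x y, S x → g x = some y → S y ∧ c x = c y + 1) (x : α) (hx : S x) :
    IsGreatest {k : ℕ | (iter g k x).isSome} (iterCount g x) ∧ iterCount g x = c x := by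
  have key : ∀ (k : ℕ) (x : α), S x → ((iter g k x).isSome ↔ k ≤ c x) := by
    intro k
    induction k with
    | zero => intro x _; simp [iter]
    | succ k ih =>
      intro x hx
      rw [iter_succ]
      cases h : g x with
      | none => have := (h0 x hx).1 h; simp [this]
      | some y =>
        obtain ⟨hy, hc⟩ := h1 x y hx h
        simp [ih y hy, hc]
  have hg : IsGreatest {k : ℕ | (iter g k x).isSome} (c x) :=
    ⟨(key _ x hx).2 le_rfl, fun k hk => (key k x hx).1 hk⟩
  have he : iterCount g x = c x := hg.csSup_eq
  exact ⟨he ▸ hg, he⟩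

theorem kashiwaraAux_eq (i : Fin (n - 1)) (m : ℕ) (w : Word n) (hw : w.length ≤ m) :
    (kashiwaraAux i m).1 w = sigE i w ∧ (kashiwaraAux i m).2 w = sigF i w := by
  induction m generalizing w with
  | zero =>
    obtain rfl : w = [] := List.length_eq_zero_iff.1 (by omega)
    simp [kashiwaraAux, sigE, sigF]
  | succ m ih =>
    match w, hw with
    | [], _ => simp [kashiwaraAux, sigE, sigF]
    | [a], _ => simp [kashiwaraAux, sigE, sigF, sig]
    | a :: b :: v, hw =>
      have hE : ∀ w : Word n, w.length ≤ m →
          iterCount (kashiwaraAux i m).1 w = (sig i w).1 := fun w hw =>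
        (iterCount_eq _ (fun w => (sig i w).1) (fun w => w.length ≤ m)
          (fun x hx => by rw [(ih x hx).1]; exact (sigE_spec i x).1)
          (fun x y hx hxy => by
            rw [(ih x hx).1] at hxy
            obtain ⟨h1, h2, _⟩ := (sigE_spec i x).2 y hxy
            exact ⟨h1.trans_le hx, h2⟩) w hw).2
      have hF : ∀ w : Word n, w.length ≤ m →
          iterCount (kashiwaraAux i m).2 w = (sig i w).2 := fun w hw =>
        (iterCount_eq _ (fun w => (sig i w).2) (fun w => w.length ≤ m)
          (fun x hx => by rw [(ih x hx).2]; exact (sigF_spec i x).1)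
          (fun x y hx hxy => by
            rw [(ih x hx).2] at hxy
            obtain ⟨h1, h2⟩ := (sigF_spec i x).2 y hxy
            exact ⟨h1.trans_le hx, h2⟩) w hw).2
      have hm : (b :: v).length ≤ m := by simpa using hw
      have hm1 : [a].length ≤ m := by simp at hm ⊢; omega
      have hsa : (sig i [a]).1 = if a = hi i then 1 else 0 := by simp [sig]
      have hea : sigE i [a] = if a = hi i then some [lo i] else none := by simp [sigE, sig]
      have hfa : sigF i [a] = if a = lo i then some [hi i] else none := by simp [sigF, sig]
      simp only [kashiwaraAux, hE _ hm1, hF _ hm, (ih _ hm1).1, (ih _ hm1).2, (ih _ hm).1,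
        (ih _ hm).2, hsa, hea, hfa]
      constructor
      · conv_rhs => rw [sigE]
        by_cases ha : a = hi i
        · by_cases h0 : (sig i (b :: v)).2 = 0 <;> simp [ha, h0]
        · simp [ha]
      · conv_rhs => rw [sigF]
        by_cases h : (sig i (b :: v)).2 ≤ (if a = hi i then 1 else 0)
        · by_cases ha : a = lo i <;> simp [h, ha]
        · simp [h]

theorem ke_eq (i : Fin (n - 1)) : ke i = sigE i :=
  funext fun w => (kashiwaraAux_eq i _ w le_rfl).1

theorem kf_eq (i : Fin (n - 1)) : kf i = sigF i :=
  funext fun w => (kashiwaraAux_eq i _ w le_rfl).2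

theorem keCount_spec (i : Fin (n - 1)) (w : Word n) :
    IsGreatest {k : ℕ | (iter (ke i) k w).isSome} (keCount i w) ∧ keCount i w = (sig i w).1 :=
  iterCount_eq (ke i) (fun w => (sig i w).1) (fun _ => True)
    (fun x _ => by rw [ke_eq]; exact (sigE_spec i x).1)
    (fun x y _ h => by rw [ke_eq] at h; exact ⟨trivial, ((sigE_spec i x).2 y h).2.1⟩) w trivial

theorem kfCount_spec (i : Fin (n - 1)) (w : Word n) :
    IsGreatest {k : ℕ | (iter (kf i) k w).isSome} (kfCount i w) ∧ kfCount i w = (sig i w).2 :=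
  iterCount_eq (kf i) (fun w => (sig i w).2) (fun _ => True)
    (fun x _ => by rw [kf_eq]; exact (sigF_spec i x).1)
    (fun x y _ h => by rw [kf_eq] at h; exact ⟨trivial, ((sigF_spec i x).2 y h).2⟩) w trivial

theorem sig_append (i : Fin (n - 1)) (u v : Word n) :
    (sig i (u ++ v)).1 = (sig i v).1 + ((sig i u).1 - (sig i v).2) ∧
    (sig i (u ++ v)).2 = (sig i u).2 + ((sig i v).2 - (sig i u).1) := by
  induction u with
  | nil => simp [sig]
  | cons a u ih =>
    obtain ⟨h1, h2⟩ := ih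
    simp only [List.cons_append, sig, h1, h2]
    omega

/-- The recursion for the raising operator, for an arbitrary factorization of a word. -/
theorem ke_append (i : Fin (n - 1)) (u v : Word n) :
    ke i (u ++ v) = if keCount i u > kfCount i v then (ke i u).map (· ++ v)
      else (ke i v).map (u ++ ·) := by
  rw [(keCount_spec i u).2, (kfCount_spec i v).2, ke_eq]
  induction u with
  | nil => simp [sig]
  | cons a u ih =>
    have h2 := (sig_append i u v).2
    rw [List.cons_append, sigE, ih, sigE, h2]
    by_cases ha : a = hi i
    · subst ha
      have hne := (lo_ne_hi i).symm
      simp only [sig, true_and, if_true]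
      split_ifs <;> first | omega | simp [Option.map_map, Function.comp_def]
    · simp only [sig, ha, false_and, if_false]
      split_ifs <;> first | omega | simp [Option.map_map, Function.comp_def]

/-- The recursion for the lowering operator, for an arbitrary factorization of a word. -/
theorem kf_append (i : Fin (n - 1)) (u v : Word n) :
    kf i (u ++ v) = if keCount i u ≥ kfCount i v then (kf i u).map (· ++ v)
      else (kf i v).map (u ++ ·) := by
  rw [(keCount_spec i u).2, (kfCount_spec i v).2, kf_eq]
  induction u with
  | nil =>
    have := (sigF_spec i v).1
    by_cases h : (sig i v).2 = 0
    · simp [sig, h, sigF, this.2 h]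
    · simp [sig, h]
  | cons a u ih =>
    have h2 := (sig_append i u v).2
    rw [List.cons_append, sigF, ih, sigF, h2]
    simp only [sig]
    split_ifs <;> first | omega | simp [Option.map_map, Function.comp_def]

end WellDefined

end QuasiCrystal

open QuasiCrystal

namespace QuasiCrystal

/-! In the signature rule each `hi i` cancels against a surviving `lo i` to its right, and `kfCount
i` counts the symbols `lo i` left over. A word therefore has no `i`-inversion exactly when nothing
cancels, that is, when `kfCount i` equals the number of symbols `lo i`; on such words both lowering
operators change the right-most `lo i`. So quasi-crystal edges are the crystal edges whose source
`x` satisfies `kfCount i x = wt x (lo i)` (`quasiCrystalGraph_iff`).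

This gives the inclusion of components, hence the second part. For the first, both sides of the
equation are invariant under a crystal isomorphism: the weight by definition, and `kfCount i`
because it is the length of the `i`-labelled path leaving the vertex (`IsComponentIso.kfCount_eq`).
Quasi-crystal edges are thus preserved and reflected, and surjectivity of the restriction follows by
applying the same argument to the inverse. -/

theorem hasInversion_cons {n : ℕ} (i : Fin (n - 1)) (a : Fin n) (v : Word n) :
    HasInversion i (a :: v) ↔ HasInversion i v ∨ (a = hi i ∧ lo i ∈ v) := by
  simp only [HasInversion, List.sublist_cons_iff, List.cons.injEq]
  constructor
  · rintro (h | ⟨r, ⟨rfl, rfl⟩, h⟩)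
    · exact Or.inl h
    · exact Or.inr ⟨rfl, List.singleton_sublist.1 h⟩
  · rintro (h | ⟨rfl, h⟩)
    · exact Or.inl h
    · exact Or.inr ⟨[lo i], ⟨rfl, rfl⟩, List.singleton_sublist.2 h⟩

theorem sig_snd_le_count {n : ℕ} (i : Fin (n - 1)) (w : Word n) :
    (sig i w).2 ≤ w.count (lo i) := by
  induction w with
  | nil => simp [sig]
  | cons a v ih =>
    simp only [sig, List.count_cons, beq_iff_eq]
    omega

/-- A word has no inversion exactly when no symbol `lo i` is cancelled in its signature. -/
theorem not_hasInversion_iff {n : ℕ} (i : Fin (n - 1)) (w : Word n) :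
    ¬ HasInversion i w ↔ (sig i w).2 = w.count (lo i) := by
  induction w with
  | nil => simp [sig, HasInversion]
  | cons a v ih =>
    -- The bound settles the case `a = hi i`: the truncated `(sig i v).2 - 1` can equal the count in
    -- `v` only if both are zero.
    have hle := sig_snd_le_count i v
    have hpos := List.count_pos_iff (a := lo i) (l := v)
    rw [hasInversion_cons, not_or, ih, ← hpos]
    simp only [sig, List.count_cons, beq_iff_eq]
    by_cases ha : a = hi i
    · simp only [ha, true_and, (lo_ne_hi i).symm, if_true, if_false]
      omega
    · simp only [ha, false_and, if_false, not_false_iff, and_true]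
      omega

theorem replaceRightmost_cons {n : ℕ} (a b c : Fin n) (v : Word n) :
    replaceRightmost a b (c :: v) =
      if a ∈ v then c :: replaceRightmost a b v else if c = a then b :: v else c :: v := by
  by_cases h : a ∈ v
  · simp [replaceRightmost, replaceLeftmost, List.replace_append, h]
  · by_cases hc : c = a
    · simp [replaceRightmost, replaceLeftmost, List.replace_append, h, hc]
    · have hc' : ¬ a = c := fun h => hc h.symm
      simp [replaceRightmost, replaceLeftmost, h, hc, hc']

/-- Without inversions `(sig i v).2` counts the symbols `lo i` in each suffix `v`, so the recursion
of `sigF` moves right exactly as long as another `lo i` lies ahead, and stops at the right-most one.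
-/
theorem qf_eq_sigF {n : ℕ} (i : Fin (n - 1)) (w : Word n) (hw : ¬ HasInversion i w) :
    qf i w = sigF i w := by
  induction w with
  | nil => simp [qf, sigF]
  | cons a v ih =>
    have hav := hw
    rw [hasInversion_cons, not_or] at hav
    have hsig := (not_hasInversion_iff i v).1 hav.1
    have ihv := ih hav.1
    by_cases h : lo i ∈ v
    · have ha : a ≠ hi i := fun ha => hav.2 ⟨ha, h⟩
      have hpos := List.count_pos_iff.2 h
      simp only [qf, hav.1, h, not_false_iff, and_self, if_true] at ihv
      simp only [qf, hw, not_false_iff, List.mem_cons, h, or_true, and_self, if_true, sigF, ← ihv,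
        replaceRightmost_cons, ha, if_false, hsig]
      rw [if_neg (by omega)]
      rfl
    · have h0 := List.count_eq_zero.2 h
      by_cases ha : a = lo i
      · subst ha
        simp [qf, hw, sigF, hsig, h0, h, replaceRightmost_cons]
      · have ha' : ¬ lo i = a := fun h => ha h.symm
        simp [qf, sigF, hsig, h0, ha, ha', h]

/-- The quasi-crystal edges are the crystal edges whose source has no inversion. -/
theorem quasiCrystalGraph_iff {n : ℕ} (i : Fin (n - 1)) (x y : Word n) :
    quasiCrystalGraph n i x y ↔
      crystalGraph n i x y ∧ kfCount i x = wt x (lo i) := by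
  rw [(kfCount_spec i x).2, quasiCrystalGraph, crystalGraph, kf_eq, wt, ← not_hasInversion_iff]
  by_cases h : HasInversion i x
  · simp [qf, h]
  · simp [qf_eq_sigF i x h, h]

theorem mem_component_of_edge {n : ℕ} {G : LabelledDigraph n} {u x y : Word n}
    {i : Fin (n - 1)} (hx : x ∈ component G u) (h : G i x y) : y ∈ component G u :=
  Relation.EqvGen.trans _ _ _ hx (.rel _ _ ⟨i, h⟩)

theorem component_subset {n : ℕ} {u w : Word n} (hw : w ∈ component (crystalGraph n) u) :
    component (quasiCrystalGraph n) w ⊆ component (crystalGraph n) u := fun _ hx =>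
  Relation.EqvGen.trans _ _ _ hw <|
    Relation.EqvGen.mono (r := fun y z => ∃ i, quasiCrystalGraph n i y z)
      (fun _ _ ⟨i, h⟩ => ⟨i, ((quasiCrystalGraph_iff i _ _).1 h).1⟩) _ _ hx

/-- Needed for surjectivity of the restricted map. -/
theorem IsComponentIso.symm {n : ℕ} {G : LabelledDigraph n} {u u' : Word n}
    {Θ : component G u → component G u'} (h : IsComponentIso G Θ) :
    IsComponentIso G (Equiv.ofBijective Θ h.bijective).symm := by
  set e := Equiv.ofBijective Θ h.bijective
  have he : ∀ x, Θ (e.symm x) = x := e.apply_symm_apply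
  refine ⟨e.symm.bijective, fun x => ?_, fun i x y => ?_⟩
  · rw [← h.wt_eq, he]
  · rw [h.edge_iff, he, he]

/-- Crystal isomorphisms preserve the number of times a lowering operator can be applied. -/
theorem IsComponentIso.kfCount_eq {n : ℕ} {u u' : Word n}
    {Θ : component (crystalGraph n) u → component (crystalGraph n) u'}
    (h : IsComponentIso (crystalGraph n) Θ) (i : Fin (n - 1))
    (x : component (crystalGraph n) u) :
    kfCount i (Θ x : Word n) = kfCount i (x : Word n) := by
  have step : ∀ x y : Word n, crystalGraph n i x y → kfCount i x = kfCount i y + 1 := by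
    intro x y hxy
    rw [crystalGraph, kf_eq] at hxy
    rw [(kfCount_spec i x).2, (kfCount_spec i y).2]
    exact ((sigF_spec i x).2 y hxy).2
  have zero : ∀ x : Word n, (∀ y, ¬ crystalGraph n i x y) ↔ kfCount i x = 0 := by
    intro x
    rw [(kfCount_spec i x).2, ← (sigF_spec i x).1, Option.eq_none_iff_forall_ne_some]
    simp only [crystalGraph, kf_eq, ne_eq]
  -- Induction along the `i`-path from `x`: it ends at `x` iff the count is 0, and each edge lowers
  -- the count by one, on both sides of `Θ`.
  obtain ⟨k, hk⟩ : ∃ k, kfCount i (x : Word n) = k := ⟨_, rfl⟩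
  induction k generalizing x with
  | zero =>
    rw [hk, ← zero]
    intro y hy
    -- An edge out of `Θ x` stays in the target component, so it pulls back to an edge out of `x`.
    obtain ⟨z, hz⟩ := h.bijective.2 ⟨y, mem_component_of_edge (Θ x).2 hy⟩
    exact (zero x).2 hk z ((h.edge_iff i x z).2 (by rw [hz]; exact hy))
  | succ k ih =>
    obtain ⟨y, hy⟩ : ∃ y, crystalGraph n i x y := by
      by_contra! hne
      have := (zero x).1 hne
      omega
    let z : component (crystalGraph n) u := ⟨y, mem_component_of_edge x.2 hy⟩
    have hxz := step x z hy
    have hΘ := step _ _ ((h.edge_iff i x z).1 hy)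
    have := ih z (by omega)
    omega

theorem IsComponentIso.quasi_edge_iff {n : ℕ} {u u' : Word n}
    {Θ : component (crystalGraph n) u → component (crystalGraph n) u'}
    (h : IsComponentIso (crystalGraph n) Θ) (i : Fin (n - 1))
    (x y : component (crystalGraph n) u) :
    quasiCrystalGraph n i (x : Word n) (y : Word n) ↔
      quasiCrystalGraph n i (Θ x : Word n) (Θ y : Word n) := by
  rw [quasiCrystalGraph_iff, quasiCrystalGraph_iff, h.edge_iff, h.kfCount_eq, h.wt_eq]

theorem IsComponentIso.mem_quasi_component {n : ℕ} {u u' : Word n}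
    {Θ : component (crystalGraph n) u → component (crystalGraph n) u'}
    (h : IsComponentIso (crystalGraph n) Θ) (w x : component (crystalGraph n) u)
    (hx : (x : Word n) ∈ component (quasiCrystalGraph n) (w : Word n)) :
    (Θ x : Word n) ∈ component (quasiCrystalGraph n) (Θ w : Word n) := by
  -- `Θ` is defined only on the crystal component, so the memberships are quantified after the
  -- chain, to allow induction on it; `component_subset` supplies membership of intermediate words.
  have key : ∀ a b : Word n, Relation.EqvGen (fun y z => ∃ i, quasiCrystalGraph n i y z) a b →
      ∀ (ha : a ∈ component (crystalGraph n) u) (hb : b ∈ component (crystalGraph n) u),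
        (Θ ⟨b, hb⟩ : Word n) ∈ component (quasiCrystalGraph n) (Θ ⟨a, ha⟩ : Word n) := by
    intro a b hab
    induction hab with
    | rel a b hab =>
      obtain ⟨i, hi⟩ := hab
      exact fun ha hb => .rel _ _ ⟨i, (h.quasi_edge_iff i ⟨a, ha⟩ ⟨b, hb⟩).1 hi⟩
    | refl a => exact fun _ _ => .refl _
    | symm a b _ ih => exact fun ha hb => .symm _ _ (ih hb ha)
    | trans a b c hab _ ih₁ ih₂ =>
      intro ha hc
      have hb := component_subset ha hab
      exact .trans _ _ _ (ih₁ ha hb) (ih₂ hb hc)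
  exact key _ _ hx w.2 x.2

end QuasiCrystal

theorem mainTheorem12 (n : ℕ) :
    (∀ (u u' : Word n)
        (Θ : component (crystalGraph n) u → component (crystalGraph n) u'),
      IsComponentIso (crystalGraph n) Θ →
      ∀ w : component (crystalGraph n) u,
        ∃ θ : component (quasiCrystalGraph n) (w : Word n) →
            component (quasiCrystalGraph n) (Θ w : Word n),
          IsComponentIso (quasiCrystalGraph n) θ ∧
          ∀ x : component (quasiCrystalGraph n) (w : Word n),
            ∃ hx : (x : Word n) ∈ component (crystalGraph n) u,
              (θ x : Word n) = (Θ ⟨x, hx⟩ : Word n)) ∧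
    (∀ u : Word n, ∃ S : Set (Word n),
      component (crystalGraph n) u = ⋃ w ∈ S, component (quasiCrystalGraph n) w) := by
  refine ⟨fun u u' Θ h w => ?_, fun u => ⟨component (crystalGraph n) u, ?_⟩⟩
  · refine ⟨fun x => ⟨Θ ⟨x, component_subset w.2 x.2⟩, h.mem_quasi_component w _ x.2⟩,
      ⟨⟨fun x y hxy => ?_, fun y => ?_⟩, fun x => h.wt_eq _, fun i x y =>
        h.quasi_edge_iff i ⟨x, component_subset w.2 x.2⟩ ⟨y, component_subset w.2 y.2⟩⟩,
      fun x => ⟨component_subset w.2 x.2, rfl⟩⟩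
    · exact Subtype.ext (Subtype.mk.inj (h.bijective.1 (Subtype.ext (Subtype.mk.inj hxy))))
    · set e := Equiv.ofBijective Θ h.bijective with he
      -- The preimage of `y` under `Θ` lies in the quasi-crystal component of `w`, because the
      -- inverse also preserves these components and sends `Θ w` to `w`.
      have hmem := h.symm.mem_quasi_component (Θ w) ⟨y, component_subset (Θ w).2 y.2⟩ y.2
      have hw : e.symm (Θ w) = w := e.symm_apply_apply w
      rw [← he, hw] at hmem
      have hy : (Θ (e.symm ⟨y, component_subset (Θ w).2 y.2⟩) : Word n) = y :=
        congrArg Subtype.val (e.apply_symm_apply ⟨y, component_subset (Θ w).2 y.2⟩)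
      exact ⟨⟨_, hmem⟩, Subtype.ext hy⟩
  · apply Set.Subset.antisymm
    · exact fun x hx => Set.mem_biUnion hx (Relation.EqvGen.refl x)
    · exact Set.iUnion₂_subset fun w hw => component_subset hw
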